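/- Let $T>0$, let $E=\{e_1,\dots,e_m\}$ be a finite set ($m\ge 1$) with the discrete metric $d_E(a,b)=\mathbb 1(a\neq b)$, and let $D$ be the set of all càdlàg functions $x:[0,T]\to E$ that are left continuous at $T$, with the Skorokhod J1 metric $$d_D(x,y)=\inf_{\lambda\in\Lambda}\max\Big\{\sup_{t\le T}|\lambda(t)-t|,\ \sup_{t\le T}d_E\big(y(\lambda(t)),x(t)\big)\Big\},$$ where $\Lambda$ is the set of strictly increasing continuous bijections of $[0,T]$ onto itself. Let $\mathcal P$ be the set of Borel probability measures on $(D,d_D)$, with the topology of weak convergence. Let $\mathbb P\in\mathcal P$ be the reference measure: under $\mathbb P$ the canonical process $X_t(x)=x(t)$ is a time-homogeneous continuous-time Markov chain (with respect to its natural filtration) with a given initial distribution $\mathbf p^{\circ}$ on $E$ and transition rate matrix $Q^0$, whose off-diagonal entries are all $1$ and whose diagonal entries are all $-(m-1)$. For a real constant $C_0$ let $$\mathcal P_0=\Big\{\mathbb Q\in\mathcal P:\ \mathbb Q\ll\mathbb P,\ \ \mathbb E^{\mathbb P}\Big[\Big(\frac{d\mathbb Q}{d\mathbb P}\Big)^2\Big]\le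 C_0\Big\}.$$ Then $\mathcal P_0$ is convex, and it is relatively compact in $\mathcal P$ (its closure in $\mathcal P$ is compact). -/

import Mathlib

open Set Filter Topology MeasureTheory
open scoped NNReal ENNReal

noncomputable section

/-- The Skorokhod space `D([0,T]; E)` for the finite state space `E = {e_1, …, e_m}`, the states
being labelled by `Fin m` (with its discrete topology): the càdlàg functions `[0,T] → E` that are
left continuous at `T`. -/
@[ext]
structure SkorokhodSpace (T : ℝ) (m : ℕ) where
  toFun : Icc (0 : ℝ) T → Fin m
  right_continuous : ∀ t, ContinuousWithinAt toFun (Ici t) t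
  left_limit : ∀ t, ∃ l, Tendsto toFun (𝓝[<] t) (𝓝 l)
  left_continuous_end : ∀ t : Icc (0 : ℝ) T, (t : ℝ) = T → ContinuousWithinAt toFun (Iic t) t

namespace SkorokhodSpace

variable {T : ℝ} {m : ℕ}

instance : CoeFun (SkorokhodSpace T m) (fun _ => Icc (0 : ℝ) T → Fin m) := ⟨toFun⟩

/-- The discrete metric on the state space. -/
def discreteDist (a b : Fin m) : ℝ := if a = b then 0 else 1

/-- The time changes: the strictly increasing bijections of `[0,T]` onto itself. Such a bijection
is automatically continuous (`OrderIso.continuous`). -/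
abbrev TimeChange (T : ℝ) : Type := Icc (0 : ℝ) T ≃o Icc (0 : ℝ) T

/-- `max {sup_t |lam t - t|, sup_t d_E (y (lam t), x t)}`. -/
def cost (lam : TimeChange T) (x y : SkorokhodSpace T m) : ℝ :=
  max (⨆ t : Icc (0 : ℝ) T, |(lam t : ℝ) - t|)
    (⨆ t : Icc (0 : ℝ) T, discreteDist (y (lam t)) (x t))

/-- The J1 metric. -/
def j1Dist (x y : SkorokhodSpace T m) : ℝ := ⨅ lam : TimeChange T, cost lam x y

lemma discreteDist_nonneg (a b : Fin m) : 0 ≤ discreteDist a b := by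
  unfold discreteDist; split_ifs <;> norm_num

lemma discreteDist_le_one (a b : Fin m) : discreteDist a b ≤ 1 := by
  unfold discreteDist; split_ifs <;> norm_num

lemma discreteDist_self (a : Fin m) : discreteDist a a = 0 := by simp [discreteDist]

lemma discreteDist_comm (a b : Fin m) : discreteDist a b = discreteDist b a := by
  simp [discreteDist, eq_comm]

lemma discreteDist_triangle (a b c : Fin m) :
    discreteDist a c ≤ discreteDist a b + discreteDist b c := by
  unfold discreteDist
  by_cases h1 : a = b <;> by_cases h2 : b = c <;> by_cases h3 : a = c <;> simp_all

lemma cost_nonneg (lam : TimeChange T) (x y : SkorokhodSpace T m) : 0 ≤ cost lam x y :=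
  le_max_of_le_left (Real.iSup_nonneg fun _ => abs_nonneg _)

lemma time_le_cost (lam : TimeChange T) (x y : SkorokhodSpace T m) (t : Icc (0 : ℝ) T) :
    |(lam t : ℝ) - t| ≤ cost lam x y := by
  refine le_max_of_le_left (le_ciSup (f := fun t : Icc (0 : ℝ) T => |(lam t : ℝ) - t|) ?_ t)
  refine ⟨T, ?_⟩
  rintro _ ⟨s, rfl⟩
  have h1 := (lam s).2
  have h2 := s.2
  simp only [mem_Icc] at h1 h2
  exact abs_le.2 ⟨by linarith, by linarith⟩

lemma value_le_cost (lam : TimeChange T) (x y : SkorokhodSpace T m) (t : Icc (0 : ℝ) T) :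
    discreteDist (y (lam t)) (x t) ≤ cost lam x y := by
  refine le_max_of_le_right
    (le_ciSup (f := fun t : Icc (0 : ℝ) T => discreteDist (y (lam t)) (x t)) ?_ t)
  refine ⟨1, ?_⟩
  rintro _ ⟨s, rfl⟩
  exact discreteDist_le_one _ _

lemma cost_le {lam : TimeChange T} {x y : SkorokhodSpace T m} {r : ℝ} (hr : 0 ≤ r)
    (h1 : ∀ t, |(lam t : ℝ) - t| ≤ r) (h2 : ∀ t, discreteDist (y (lam t)) (x t) ≤ r) :
    cost lam x y ≤ r :=
  max_le (Real.iSup_le h1 hr) (Real.iSup_le h2 hr)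

lemma j1Dist_le_cost (lam : TimeChange T) (x y : SkorokhodSpace T m) :
    j1Dist x y ≤ cost lam x y :=
  ciInf_le ⟨0, by rintro _ ⟨l, rfl⟩; exact cost_nonneg _ _ _⟩ lam

lemma j1Dist_nonneg (x y : SkorokhodSpace T m) : 0 ≤ j1Dist x y :=
  Real.iInf_nonneg fun _ => cost_nonneg _ _ _

lemma exists_cost_lt {x y : SkorokhodSpace T m} {r : ℝ} (h : j1Dist x y < r) :
    ∃ lam : TimeChange T, cost lam x y < r :=
  exists_lt_of_ciInf_lt h

lemma cost_symm_le (lam : TimeChange T) (x y : SkorokhodSpace T m) :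
    cost lam.symm y x ≤ cost lam x y := by
  refine cost_le (cost_nonneg _ _ _) (fun t => ?_) (fun t => ?_)
  · have h := time_le_cost lam x y (lam.symm t)
    rw [OrderIso.apply_symm_apply] at h
    rwa [abs_sub_comm]
  · have h := value_le_cost lam x y (lam.symm t)
    rw [OrderIso.apply_symm_apply] at h
    rwa [discreteDist_comm]

lemma j1Dist_comm_le (x y : SkorokhodSpace T m) : j1Dist y x ≤ j1Dist x y :=
  le_ciInf fun lam => (j1Dist_le_cost lam.symm y x).trans (cost_symm_le lam x y)

lemma cost_trans_le (lam mu : TimeChange T) (x y z : SkorokhodSpace T m) :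
    cost (lam.trans mu) x z ≤ cost lam x y + cost mu y z := by
  refine cost_le (add_nonneg (cost_nonneg _ _ _) (cost_nonneg _ _ _)) (fun t => ?_) (fun t => ?_)
  · have h1 := time_le_cost lam x y t
    have h2 := time_le_cost mu y z (lam t)
    have h3 := abs_sub_le ((mu (lam t) : Icc (0 : ℝ) T) : ℝ) (lam t) t
    simp only [OrderIso.trans_apply]
    linarith
  · have h1 := value_le_cost lam x y t
    have h2 := value_le_cost mu y z (lam t)
    have h3 := discreteDist_triangle (z (mu (lam t))) (y (lam t)) (x t)
    simp only [OrderIso.trans_apply]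
    linarith

lemma eq_comp_of_cost_lt_one {lam : TimeChange T} {x y : SkorokhodSpace T m}
    (h : cost lam x y < 1) (t : Icc (0 : ℝ) T) : y (lam t) = x t := by
  have h1 := (value_le_cost lam x y t).trans_lt h
  by_contra hne
  simp [discreteDist, hne] at h1

lemma exists_const_right (x : SkorokhodSpace T m) (t : Icc (0 : ℝ) T) :
    ∃ δ > 0, ∀ s : Icc (0 : ℝ) T, (t : ℝ) ≤ s → (s : ℝ) < t + δ → x s = x t := by
  have h : ∀ᶠ s in 𝓝[Ici t] t, x s = x t :=
    x.right_continuous t (by simp : ({x t} : Set (Fin m)) ∈ 𝓝 (x t))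
  obtain ⟨δ, hδ, hs⟩ := Metric.mem_nhdsWithin_iff.1 h
  refine ⟨δ, hδ, fun s h1 h2 => hs ⟨?_, h1⟩⟩
  rw [Metric.mem_ball, Subtype.dist_eq, Real.dist_eq, abs_of_nonneg (by linarith)]
  linarith

lemma eq_of_j1Dist_eq_zero {x y : SkorokhodSpace T m} (h : j1Dist x y = 0) : x = y := by
  ext1
  funext t
  rcases eq_or_lt_of_le t.2.2 with hT | hT
  · obtain ⟨lam, hlam⟩ := exists_cost_lt (h.trans_lt one_pos)
    have htop : ∀ s : Icc (0 : ℝ) T, s ≤ t := fun s => Subtype.coe_le_coe.1 (s.2.2.trans hT.ge)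
    have hfix : lam t = t := by
      refine le_antisymm (htop _) ?_
      simpa using lam.monotone (htop (lam.symm t))
    rw [← eq_comp_of_cost_lt_one hlam t, hfix]
  · obtain ⟨δ₁, hδ₁, h₁⟩ := exists_const_right x t
    obtain ⟨δ₂, hδ₂, h₂⟩ := exists_const_right y t
    obtain ⟨η, hη, hη₁, hη₂, hηT⟩ :
        ∃ η : ℝ, 0 < η ∧ 2 * η < δ₁ ∧ 2 * η < δ₂ ∧ (t : ℝ) + η ≤ T := by
      refine ⟨min (min δ₁ δ₂) (T - t) / 3, ?_, ?_, ?_, ?_⟩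
      · have : 0 < min (min δ₁ δ₂) (T - t) := lt_min (lt_min hδ₁ hδ₂) (by linarith)
        linarith
      · have := (min_le_left (min δ₁ δ₂) (T - t)).trans (min_le_left _ _)
        linarith
      · have := (min_le_left (min δ₁ δ₂) (T - t)).trans (min_le_right _ _)
        linarith
      · have := min_le_right (min δ₁ δ₂) (T - t)
        linarith
    obtain ⟨lam, hlam⟩ := exists_cost_lt (h.trans_lt (lt_min one_pos hη))
    let s : Icc (0 : ℝ) T := ⟨t + η, by linarith [t.2.1], hηT⟩
    have hs : (s : ℝ) = t + η := rfl
    have hmove := abs_lt.1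
      ((time_le_cost lam x y s).trans_lt (hlam.trans_le (min_le_right _ _)))
    have hval := eq_comp_of_cost_lt_one (hlam.trans_le (min_le_left _ _)) s
    rw [h₁ s (by linarith) (by linarith), h₂ (lam s) (by linarith) (by linarith)] at hval
    exact hval.symm

instance : MetricSpace (SkorokhodSpace T m) where
  dist := j1Dist
  dist_self x := by
    refine le_antisymm ((j1Dist_le_cost (OrderIso.refl _) x x).trans ?_) (j1Dist_nonneg x x)
    exact cost_le le_rfl (fun t => by simp) (fun t => by simp [discreteDist_self])
  dist_comm x y := le_antisymm (j1Dist_comm_le y x) (j1Dist_comm_le x y)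
  dist_triangle x y z := by
    refine le_of_forall_pos_lt_add fun ε hε => ?_
    obtain ⟨lam, hlam⟩ := exists_cost_lt (lt_add_of_pos_right (j1Dist x y) (half_pos hε))
    obtain ⟨mu, hmu⟩ := exists_cost_lt (lt_add_of_pos_right (j1Dist y z) (half_pos hε))
    have h1 := j1Dist_le_cost (lam.trans mu) x z
    have h2 := cost_trans_le lam mu x y z
    change j1Dist x z < j1Dist x y + j1Dist y z + ε
    linarith
  eq_of_dist_eq_zero h := eq_of_j1Dist_eq_zero h

instance : MeasurableSpace (SkorokhodSpace T m) := borel _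

instance : BorelSpace (SkorokhodSpace T m) := ⟨rfl⟩

/-- The natural filtration `F_t = σ(X_s, s ≤ t)` of the canonical process `X_t(x) = x t`. -/
@[reducible] def naturalFiltration (T : ℝ) (m : ℕ) (t : Icc (0 : ℝ) T) :
    MeasurableSpace (SkorokhodSpace T m) :=
  ⨆ s : Iic t, MeasurableSpace.comap (fun x : SkorokhodSpace T m => x s) ⊤

end SkorokhodSpace

/-- The transition rate matrix `Q⁰`: all off-diagonal entries `1`, all diagonal entries
`-(m - 1)`. -/
def referenceRateMatrix (m : ℕ) : Matrix (Fin m) (Fin m) ℝ :=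
  Matrix.of fun i j => if i = j then -((m : ℝ) - 1) else 1

/-- `P` is the reference measure with initial distribution `p₀`: under `P` the canonical process is
a (time-homogeneous) continuous-time Markov chain with initial distribution `p₀` and transition
rate matrix `Q⁰`. The Markov property `P[X_t = j | F_s] = (exp ((t - s) Q⁰))_{X_s, j}` is written
out by integrating over the events `A ∩ {X_s = i}` with `A ∈ F_s`. -/
structure IsReferenceMeasure {T : ℝ} {m : ℕ} (p₀ : Fin m → ℝ)
    (P : ProbabilityMeasure (SkorokhodSpace T m)) : Prop where
  initial : ∀ t₀ : Icc (0 : ℝ) T, (t₀ : ℝ) = 0 → ∀ i : Fin m,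
    (P : Measure (SkorokhodSpace T m)).real {x | x t₀ = i} = p₀ i
  markov : ∀ s t : Icc (0 : ℝ) T, s ≤ t → ∀ A : Set (SkorokhodSpace T m),
    MeasurableSet[SkorokhodSpace.naturalFiltration T m s] A → ∀ i j : Fin m,
      (P : Measure (SkorokhodSpace T m)).real (A ∩ {x | x s = i} ∩ {x | x t = j}) =
        (P : Measure (SkorokhodSpace T m)).real (A ∩ {x | x s = i}) *
          NormedSpace.exp (((t : ℝ) - s) • referenceRateMatrix m) i j

/-- The set `P_0` of the probability measures `Q` on the Skorokhod space that have a density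
`L = dQ/dP` with respect to `P` with `E^P[L²] ≤ C₀`. -/
def boundedDensitySet {T : ℝ} {m : ℕ} (P : ProbabilityMeasure (SkorokhodSpace T m)) (C₀ : ℝ) :
    Set (ProbabilityMeasure (SkorokhodSpace T m)) :=
  {Q | (Q : Measure (SkorokhodSpace T m)) ≪ (P : Measure (SkorokhodSpace T m)) ∧
    ∫⁻ x, ((Q : Measure (SkorokhodSpace T m)).rnDeriv (P : Measure (SkorokhodSpace T m)) x) ^ 2
      ∂(P : Measure (SkorokhodSpace T m)) ≤ ENNReal.ofReal C₀}

end

open BoundedContinuousFunction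

/-! Convexity holds because the Radon–Nikodym derivative is linear in the measure and squaring is
convex. Compactness comes from duality in `L²(P)`. By Riesz, a density with second moment at most
`C` is a functional of norm at most `√C`. The ball of such functionals is weak-* compact by
Banach–Alaoglu, and positivity and unit mass are weak-* closed conditions. Sending a functional to
its measure is continuous for weak convergence, since integrating a bounded continuous `f` is
evaluation at the `L²` class of `f` (`integral_measureOfFunctional`). The set in question lies in
the compact image (`exists_measureOfFunctional_eq`). -/

section General

variable {Ω : Type*} [MeasurableSpace Ω]

/-- The square of the `L²` norm of the density of a convex combination is at most the convex
combination of the squares. -/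
lemma lintegral_sq_rnDeriv_convexCombo_le (P μ ν : Measure Ω) [IsFiniteMeasure P]
    [IsFiniteMeasure μ] [IsFiniteMeasure ν] {a b : ℝ≥0} (hab : a + b = 1) :
    ∫⁻ x, ((a • μ + b • ν).rnDeriv P x) ^ 2 ∂P ≤
      a * ∫⁻ x, (μ.rnDeriv P x) ^ 2 ∂P + b * ∫⁻ x, (ν.rnDeriv P x) ^ 2 ∂P := by
  have hab' : (a : ℝ≥0∞) + b = 1 := by exact_mod_cast hab
  rw [← lintegral_const_mul _ (by fun_prop), ← lintegral_const_mul _ (by fun_prop),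
    ← lintegral_add_left (by fun_prop)]
  refine lintegral_mono_ae ?_
  filter_upwards [Measure.rnDeriv_add (a • μ) (b • ν) P, Measure.rnDeriv_smul_left μ P a,
    Measure.rnDeriv_smul_left ν P b] with x h hμ hν
  rw [h, Pi.add_apply, hμ, hν]
  -- Pointwise two-point Jensen inequality for `t ↦ t ^ 2`.
  simpa [ENNReal.smul_def] using ENNReal.rpow_arith_mean_le_arith_mean2_rpow a b
    (μ.rnDeriv P x) (ν.rnDeriv P x) hab' one_le_two

/-- The probability measures with a density with respect to `P` whose second moment is at most `c`
form a convex set. -/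
lemma convex_image_boundedDensity (P : ProbabilityMeasure Ω) (c : ℝ≥0∞) :
    Convex ℝ≥0 ((fun Q : ProbabilityMeasure Ω => (Q : Measure Ω)) ''
      {Q | (Q : Measure Ω) ≪ P ∧ ∫⁻ x, ((Q : Measure Ω).rnDeriv P x) ^ 2 ∂(P : Measure Ω) ≤ c}) := by
  rintro _ ⟨Q₁, ⟨hac₁, h₁⟩, rfl⟩ _ ⟨Q₂, ⟨hac₂, h₂⟩, rfl⟩ a b - - hab
  have hab' : (a : ℝ≥0∞) + b = 1 := by exact_mod_cast hab
  have hprob : IsProbabilityMeasure (a • (Q₁ : Measure Ω) + b • (Q₂ : Measure Ω)) :=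
    ⟨by
    rw [Measure.add_apply, Measure.smul_apply, Measure.smul_apply, measure_univ, measure_univ,
      ENNReal.smul_def, ENNReal.smul_def, smul_eq_mul, smul_eq_mul, mul_one, mul_one, hab']⟩
  refine ⟨⟨_, hprob⟩, ⟨(hac₁.smul_left a).add_left (hac₂.smul_left b), ?_⟩, rfl⟩
  calc ∫⁻ x, ((a • (Q₁ : Measure Ω) + b • (Q₂ : Measure Ω)).rnDeriv P x) ^ 2 ∂(P : Measure Ω)
      ≤ _ := lintegral_sq_rnDeriv_convexCombo_le _ _ _ hab
    _ ≤ a * c + b * c := by gcongr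
    _ = c := by rw [← add_mul, hab', one_mul]

/-! ### Weak-* compactness and Riesz representation -/

/-- The functionals on `L²(P)` of norm at most `R` that are nonnegative on indicators and map the
constant `1` to `1`: these are the functionals represented by probability densities. -/
def densityFunctionals (P : Measure Ω) [IsFiniteMeasure P] (R : ℝ) :
    Set (WeakDual ℝ (Lp ℝ 2 P)) :=
  (WeakDual.toStrongDual ⁻¹' Metric.closedBall 0 R) ∩
    ({φ | ∀ (s : Set Ω) (hs : MeasurableSet s),
      0 ≤ φ (indicatorConstLp 2 hs (measure_ne_top P s) 1)} ∩
      {φ | φ (indicatorConstLp 2 MeasurableSet.univ (measure_ne_top P univ) 1) = 1})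

/-- Both side conditions constrain evaluations at fixed vectors, which are weak-* continuous, so
they cut a closed subset out of the Banach–Alaoglu ball. -/
lemma isCompact_densityFunctionals (P : Measure Ω) [IsFiniteMeasure P] (R : ℝ) :
    IsCompact (densityFunctionals P R) := by
  refine (WeakDual.isCompact_closedBall 0 R).inter_right (IsClosed.inter ?_ ?_)
  · simp only [ofPred_forall]
    exact isClosed_iInter fun s => isClosed_iInter fun hs =>
      isClosed_le continuous_const (WeakDual.eval_continuous _)
  · exact isClosed_eq (WeakDual.eval_continuous _) continuous_const

/-- The Riesz representative in `L²(P)` of a functional. -/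
noncomputable def rieszDensity {P : Measure Ω} (φ : WeakDual ℝ (Lp ℝ 2 P)) : Lp ℝ 2 P :=
  (InnerProductSpace.toDual ℝ (Lp ℝ 2 P)).symm (WeakDual.toStrongDual φ)

lemma inner_rieszDensity {P : Measure Ω} (φ : WeakDual ℝ (Lp ℝ 2 P)) (f : Lp ℝ 2 P) :
    inner ℝ (rieszDensity φ) f = φ f :=
  InnerProductSpace.toDual_symm_apply

variable {P : Measure Ω} [IsFiniteMeasure P] {R : ℝ}

lemma integrable_of_Lp_two (f : Lp ℝ 2 P) : Integrable f P :=
  (Lp.memLp f).integrable one_le_two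

lemma setIntegral_rieszDensity (φ : WeakDual ℝ (Lp ℝ 2 P)) {s : Set Ω} (hs : MeasurableSet s) :
    ∫ x in s, rieszDensity φ x ∂P = φ (indicatorConstLp 2 hs (measure_ne_top P s) 1) := by
  rw [← inner_rieszDensity, real_inner_comm, L2.inner_indicatorConstLp_one]

lemma rieszDensity_nonneg {φ : WeakDual ℝ (Lp ℝ 2 P)} (hφ : φ ∈ densityFunctionals P R) :
    0 ≤ᵐ[P] rieszDensity φ :=
  ae_nonneg_of_forall_setIntegral_nonneg (integrable_of_Lp_two _) fun s hs _ => by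
    rw [setIntegral_rieszDensity φ hs]
    exact hφ.2.1 s hs

/-- The probability measure whose density represents the given functional. -/
noncomputable def measureOfFunctional (φ : densityFunctionals P R) : ProbabilityMeasure Ω :=
  -- `ENNReal.ofReal` changes the representative only on a null set, by `rieszDensity_nonneg`; the
  -- value of `φ` at the constant `1` is the total mass.
  ⟨P.withDensity fun x => ENNReal.ofReal (rieszDensity φ.1 x), ⟨by
    rw [withDensity_apply _ MeasurableSet.univ, Measure.restrict_univ,
      ← ofReal_integral_eq_lintegral_ofReal (integrable_of_Lp_two _) (rieszDensity_nonneg φ.2),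
      ← setIntegral_univ, setIntegral_rieszDensity _ MeasurableSet.univ, φ.2.2.2,
      ENNReal.ofReal_one]⟩⟩

/-- The functional is the inner product with the density itself, which is in `L²(P)` by the moment
bound. -/
lemma exists_measureOfFunctional_eq {Q : ProbabilityMeasure Ω} (hQ : (Q : Measure Ω) ≪ P) {C : ℝ}
    (hC : ∫⁻ x, ((Q : Measure Ω).rnDeriv P x) ^ 2 ∂P ≤ ENNReal.ofReal C) :
    ∃ φ : densityFunctionals P (√C), measureOfFunctional φ = Q := by
  set g : Ω → ℝ := fun x => ((Q : Measure Ω).rnDeriv P x).toReal with hg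
  have hgm : Measurable g := (Measure.measurable_rnDeriv _ _).ennreal_toReal
  have hfin : ∀ᵐ x ∂P, (Q : Measure Ω).rnDeriv P x < ∞ := Measure.rnDeriv_lt_top _ _
  have hnorm : eLpNorm g 2 P ^ 2 ≤ ENNReal.ofReal C := by
    have h := eLpNorm_nnreal_pow_eq_lintegral (f := g) (μ := P) (p := 2) two_ne_zero
    have h' : ∫⁻ x, ‖g x‖ₑ ^ (2 : ℝ) ∂P = ∫⁻ x, ((Q : Measure Ω).rnDeriv P x) ^ 2 ∂P := by
      refine lintegral_congr_ae ?_
      filter_upwards [hfin] with x hx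
      simp [hg, hx.ne, Real.enorm_eq_ofReal]
    norm_num at h
    rw [h]
    simpa using h'.le.trans hC
  have hmem : MemLp g 2 P := by
    refine ⟨hgm.aestronglyMeasurable, ?_⟩
    by_contra hne
    simp [not_lt_top_iff.1 hne] at hnorm
  let L : Lp ℝ 2 P := hmem.toLp g
  have hL : L =ᵐ[P] g := hmem.coeFn_toLp
  let φ : WeakDual ℝ (Lp ℝ 2 P) :=
    StrongDual.toWeakDual (InnerProductSpace.toDual ℝ (Lp ℝ 2 P) L)
  have hφL : rieszDensity φ = L := by simp [rieszDensity, φ]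
  have hset : ∀ s, MeasurableSet s → ∫ x in s, rieszDensity φ x ∂P = (Q : Measure Ω).real s := by
    intro s hs
    rw [hφL, integral_congr_ae (ae_restrict_of_ae hL)]
    exact Measure.setIntegral_toReal_rnDeriv hQ s
  have hφ : φ ∈ densityFunctionals P (√C) := by
    refine ⟨?_, fun s hs => ?_, ?_⟩
    · rw [mem_preimage, mem_closedBall_zero_iff]
      change ‖InnerProductSpace.toDual ℝ (Lp ℝ 2 P) L‖ ≤ √C
      rw [LinearIsometryEquiv.norm_map, Lp.norm_toLp]
      refine Real.le_sqrt_of_sq_le ?_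
      -- For negative `C` the bound `ENNReal.ofReal C` is `0`; the density would vanish a.e. and `Q`
      -- would be the zero measure.
      have hpos : 0 ≤ C := by
        by_contra! hneg
        rw [ENNReal.ofReal_of_nonpos hneg.le] at hC
        have h0 : (Q : Measure Ω) = 0 := by
          have hz := (lintegral_eq_zero_iff (by fun_prop)).1 (le_antisymm hC zero_le)
          rw [← Measure.withDensity_rnDeriv_eq _ _ hQ, withDensity_eq_zero_iff (by fun_prop)]
          filter_upwards [hz] with x hx
          simpa using hx
        exact IsProbabilityMeasure.ne_zero _ h0
      rw [← ENNReal.toReal_pow]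
      exact ENNReal.toReal_le_of_le_ofReal hpos hnorm
    · rw [← setIntegral_rieszDensity, hset s hs]
      exact measureReal_nonneg
    · rw [mem_ofPred_eq, ← setIntegral_rieszDensity, hset _ MeasurableSet.univ]
      exact probReal_univ
  refine ⟨⟨φ, hφ⟩, Subtype.ext ?_⟩
  change P.withDensity (fun x => ENNReal.ofReal (rieszDensity φ x)) = Q
  rw [← Measure.withDensity_rnDeriv_eq _ _ hQ, hφL]
  refine withDensity_congr_ae ?_
  filter_upwards [hL, hfin] with x hx hx'
  rw [hx, hg, ENNReal.ofReal_toReal hx'.ne]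

/-! ### Weak-* convergence gives weak convergence of measures -/

variable [TopologicalSpace Ω] [BorelSpace Ω]

lemma integral_measureOfFunctional (φ : densityFunctionals P R) (f : Ω →ᵇ ℝ) :
    ∫ x, f x ∂(measureOfFunctional φ : Measure Ω) =
      φ.1 (BoundedContinuousFunction.toLp 2 P ℝ f) := by
  have hmeas : AEMeasurable (rieszDensity φ.1) P := (Lp.aestronglyMeasurable _).aemeasurable
  change ∫ x, f x ∂(P.withDensity fun x => ENNReal.ofReal (rieszDensity φ.1 x)) = _
  rw [integral_withDensity_eq_integral_toReal_smul₀ hmeas.ennreal_ofReal (by simp),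
    ← inner_rieszDensity, L2.inner_def]
  refine integral_congr_ae ?_
  filter_upwards [rieszDensity_nonneg φ.2, BoundedContinuousFunction.coeFn_toLp (p := 2) P ℝ f]
    with x hx hf
  rw [hf, ENNReal.toReal_ofReal hx, smul_eq_mul]
  simp [mul_comm]

lemma continuous_measureOfFunctional :
    Continuous (measureOfFunctional : densityFunctionals P R → ProbabilityMeasure Ω) := by
  rw [ProbabilityMeasure.continuous_iff_forall_continuous_integral]
  intro f
  simp_rw [integral_measureOfFunctional]
  exact (WeakDual.eval_continuous _).comp continuous_subtype_val

lemma isCompact_range_measureOfFunctional :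
    IsCompact (range (measureOfFunctional : densityFunctionals P R → ProbabilityMeasure Ω)) := by
  have := isCompact_iff_compactSpace.1 (isCompact_densityFunctionals P R)
  exact isCompact_range continuous_measureOfFunctional

/-- The probability measures with a density with respect to `P` whose second moment is at most `C`
form a relatively compact set for the topology of weak convergence. -/
theorem isCompact_closure_boundedDensity [HasOuterApproxClosed Ω] (P : Measure Ω)
    [IsFiniteMeasure P] (C : ℝ) :
    IsCompact (closure {Q : ProbabilityMeasure Ω | (Q : Measure Ω) ≪ P ∧
      ∫⁻ x, ((Q : Measure Ω).rnDeriv P x) ^ 2 ∂P ≤ ENNReal.ofReal C}) :=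
  -- The range is compact in a Hausdorff space, hence closed, so it contains the closure.
  (isCompact_range_measureOfFunctional (P := P) (R := √C)).closure_of_subset fun _ hQ =>
    exists_measureOfFunctional_eq hQ.1 hQ.2

end General

/-- Convex combinations are taken in `Measure`, whose natural scalars are nonnegative; hence the
image under coercion and convexity over `ℝ≥0`. -/
theorem mainTheorem8 (T : ℝ) (hT : 0 < T) (m : ℕ) (p₀ : Fin m → ℝ)
    (hp₀ : p₀ ∈ stdSimplex ℝ (Fin m))
    (P : ProbabilityMeasure (SkorokhodSpace T m)) (hP : IsReferenceMeasure p₀ P) (C₀ : ℝ) :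
    Convex ℝ≥0 ((fun Q : ProbabilityMeasure (SkorokhodSpace T m) =>
        (Q : Measure (SkorokhodSpace T m))) '' boundedDensitySet P C₀) ∧
      IsCompact (closure (boundedDensitySet P C₀)) :=
  ⟨convex_image_boundedDensity P _, isCompact_closure_boundedDensity _ C₀⟩
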